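/- Let $n>1$ be an integer, $\mathcal D$ a set (the data domain), and $\mathcal S^{(1)},\dots,\mathcal S^{(n)}$ measurable spaces. For $i\in[n]$ let $\mathcal A^{(i)}\colon \mathcal S^{(1)}\times\cdots\times\mathcal S^{(i-1)}\times\mathcal D\to\mathcal S^{(i)}$ be a randomized algorithm: for each $x\in\mathcal D$ the law of $\mathcal A^{(i)}(z_{1:i-1};x)$ is a probability kernel from $\mathcal S^{(1)}\times\cdots\times\mathcal S^{(i-1)}$ to $\mathcal S^{(i)}$. Let $\varepsilon_0>0$ and suppose that each $\mathcal A^{(i)}$ is $\varepsilon_0$-differentially private in its data element for all values of the auxiliary inputs, that is, $$\Pr[\mathcal A^{(i)}(s;x)\in B]\le e^{\varepsilon_0}\Pr[\mathcal A^{(i)}(s;x')\in B]$$ for all $s\in\mathcal S^{(1)}\times\cdots\times\mathcal S^{(i-1)}$, all $x,x'\in\mathcal D$ and all measurable $B\subseteq\mathcal S^{(i)}$. Let $\mathcal A_{\mathsf{swap}}\colon\mathcal D^n\to\mathcal S^{(1)}\times\cdots\times\mathcal S^{(n)}$ be the algorithm that, given $D=(x_1,\dots,x_n)$, draws an index $I$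 uniformly from $[n]$, exchanges the elements of $D$ at positions $1$ and $I$ to obtain a dataset $(y_1,\dots,y_n)$, then for $i=1,\dots,n$ sequentially draws $z_i\leftarrow\mathcal A^{(i)}(z_{1:i-1};y_i)$ (with fresh randomness), and outputs $(z_1,\dots,z_n)$. Then for every $\delta>0$ the algorithm $\mathcal A_{\mathsf{swap}}$ is $(\varepsilon,\delta)$-differentially private at index $1$ with $$\varepsilon=\varepsilon_1\sqrt{2n\log(1/\delta)}+n\varepsilon_1\left(e^{\varepsilon_1}-1\right),\qquad \varepsilon_1=\frac{2e^{2\varepsilon_0}\left(e^{\varepsilon_0}-1\right)}{n},$$ that is, for all $D,D'\in\mathcal D^n$ that differ at most in their first element and all measurable $B\subseteq\mathcal S^{(1)}\times\cdots\times\mathcal S^{(n)}$, $$\Pr[\mathcal A_{\mathsf{swap}}(D)\in B]\le e^{\varepsilon}\Pr[\mathcal A_{\mathsf{swap}}(D')\in B]+\delta .$$ Here $\log$ is the natural logarithm, and for $\delta>1$ (where the claim is trivial) the square root is read as $0$. -/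

import Mathlib

open MeasureTheory ProbabilityTheory
open scoped ENNReal

universe u v

/-- A randomized algorithm is represented by its output law `M x` on each input `x`.
It is `(ε, δ)`-differentially private with respect to an adjacency relation `adj` on inputs if
`Pr[M x ∈ B] ≤ e ^ ε * Pr[M x' ∈ B] + δ` for all adjacent `x`, `x'` and all measurable `B`. -/
def IsDP {X : Type u} {T : Type v} [MeasurableSpace T] (adj : X → X → Prop)
    (M : X → Measure T) (ε δ : ℝ) : Prop :=
  ∀ x x' : X, adj x x' → ∀ B : Set T, MeasurableSet B →
    M x B ≤ ENNReal.ofReal (Real.exp ε) * M x' B + ENNReal.ofReal δ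

/-- Two datasets of length `n` that differ at most in the element with index `i`. -/
def DifferAt {n : ℕ} {X : Type u} (i : Fin n) (D D' : Fin n → X) : Prop :=
  ∀ j : Fin n, j ≠ i → D j = D' j

/-- The space of the first `k` responses, `S 0 × ⋯ × S (k - 1)` (indices start at `0`). For `k = n`
this is the full product `(j : Fin n) → S j`. -/
abbrev Transcript {n : ℕ} (S : Fin n → Type v) (k : ℕ) (hk : k ≤ n) : Type v :=
  (j : Fin k) → S (Fin.castLE hk j)

/-- Adaptive randomizers: the `i`-th one receives the `i` earlier responses and one data
element `x : X`, and outputs a random element of `S i`. For every fixed `x` it is a kernel in the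
earlier responses; that it is a probability kernel is required where the randomizers are used. -/
abbrev Randomizers {n : ℕ} (X : Type u) (S : Fin n → Type v) [∀ i, MeasurableSpace (S i)] :
    Type (max u v) :=
  (i : Fin n) → X → Kernel (Transcript S i i.isLt.le) (S i)

/-- Append the response of the randomizer with index `k` to the first `k` responses. -/
def Transcript.append {n : ℕ} {S : Fin n → Type v} {k : ℕ} (hk : k + 1 ≤ n)
    (p : Transcript S k (Nat.le_of_succ_le hk) × S ⟨k, hk⟩) : Transcript S (k + 1) hk :=
  Fin.snoc (α := fun j : Fin (k + 1) => S (Fin.castLE hk j)) p.1 p.2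

/-- The law of the first `k` responses when the randomizers are applied sequentially to the
dataset `D`: response `k` is drawn from `R k (D k)` given the earlier responses. -/
noncomputable def localPrefix {n : ℕ} {X : Type u} {S : Fin n → Type v}
    [∀ i, MeasurableSpace (S i)] (R : Randomizers X S) (D : Fin n → X) :
    (k : ℕ) → (hk : k ≤ n) → Measure (Transcript S k hk)
  | 0, _ => Measure.dirac (fun j => j.elim0)
  | k + 1, hk =>
    (localPrefix R D k (Nat.le_of_succ_le hk) ⊗ₘ R ⟨k, hk⟩ (D ⟨k, hk⟩)).map (Transcript.append hk)

/-- Local responses: the law of all `n` responses on the dataset `D`. -/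
noncomputable def localResponses {n : ℕ} {X : Type u} {S : Fin n → Type v}
    [∀ i, MeasurableSpace (S i)] (R : Randomizers X S) (D : Fin n → X) :
    Measure ((j : Fin n) → S j) :=
  localPrefix R D n le_rfl

/-- Local responses with one swap: draw an index `I` uniformly from the `n` indices, exchange the
first element of `D` with the element at index `I`, and apply the randomizers sequentially. -/
noncomputable def swapResponses {n : ℕ} {X : Type u} {S : Fin n → Type v}
    [∀ i, MeasurableSpace (S i)] (R : Randomizers X S) (hn : 0 < n) (D : Fin n → X) :
    Measure ((j : Fin n) → S j) :=
  ∑ I : Fin n, (n : ℝ≥0∞)⁻¹ • localResponses R (D ∘ Equiv.swap ⟨0, hn⟩ I)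

theorem Transcript.measurable_append {n : ℕ} {S : Fin n → Type v} [∀ i, MeasurableSpace (S i)]
    {k : ℕ} (hk : k + 1 ≤ n) : Measurable (Transcript.append (S := S) hk) := by
  refine measurable_pi_iff.2 fun j => ?_
  induction j using Fin.lastCases with
  | last =>
    simp only [Transcript.append, Fin.snoc_last]
    exact measurable_snd
  | cast j =>
    simp only [Transcript.append, Fin.snoc_castSucc]
    exact (measurable_pi_apply j).comp measurable_fst

instance localPrefix.isProbabilityMeasure {n : ℕ} {X : Type u} {S : Fin n → Type v}
    [∀ i, MeasurableSpace (S i)] (R : Randomizers X S) [∀ i x, IsMarkovKernel (R i x)]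
    (D : Fin n → X) (k : ℕ) (hk : k ≤ n) : IsProbabilityMeasure (localPrefix R D k hk) := by
  induction k with
  | zero => unfold localPrefix; infer_instance
  | succ k ih =>
    have := ih (Nat.le_of_succ_le hk)
    unfold localPrefix
    exact Measure.isProbabilityMeasure_map (Transcript.measurable_append hk).aemeasurable

theorem swapResponses.isProbabilityMeasure {n : ℕ} {X : Type u} {S : Fin n → Type v}
    [∀ i, MeasurableSpace (S i)] (R : Randomizers X S) [∀ i x, IsMarkovKernel (R i x)]
    (hn : 0 < n) (D : Fin n → X) : IsProbabilityMeasure (swapResponses R hn D) := by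
  have h : ∀ D : Fin n → X, localResponses R D Set.univ = 1 := fun D =>
    (localPrefix.isProbabilityMeasure R D n le_rfl).measure_univ
  refine ⟨?_⟩
  simp only [swapResponses, Measure.coe_finsetSum, Finset.sum_apply, Measure.smul_apply, h,
    smul_eq_mul, mul_one, Finset.sum_const, Finset.card_univ, Fintype.card_fin, nsmul_eq_mul]
  exact ENNReal.mul_inv_cancel (by exact_mod_cast hn.ne') (ENNReal.natCast_ne_top n)

/-!
The responses of the swapped algorithm form an adaptive composition of `n` algorithms, the `k`-th
of which draws the response with index `k` from its conditional law given the earlier responses.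

*Amplification.* Given the earlier responses, the first data element enters the response with index
`k` only if the drawn index is `k`. As datasets obtained by two different swaps differ below
position `k` in at most two places, the posterior probability of this event is at most
`e ^ (2 * ε₀) / n` (`swapPrefixAt_le`). Mixing in a response to the first element instead of a
response to the element with index `k` therefore changes the conditional law by a factor of at
most `1 + (e ^ ε₀ - 1) * e ^ (2 * ε₀) / n ≤ e ^ (ε₁ / 2)` in either direction. A comparison of both
datasets with the unmixed law gives `ε₁`-privacy of each response (`swapPrefix_succ_le`).

*Composition.* Conditional laws need not exist on arbitrary measurable spaces, so privacy given the
past is stated for densities `f k` of the laws of the first `k` responses on the two datasets: the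
ratio `f (k + 1) / f k` takes values in `[e ^ (-ε₁), e ^ ε₁]`. Its conditional mean is `1`, so by
convexity the moment of order `1 + l` grows in each round by at most the moment of randomized
response, which is at most `exp (l * ε₁ * (e ^ ε₁ - 1) + (l * ε₁) ^ 2 / 2)`
(`IsDensityWithMoment.exists_extension`). A Chernoff bound with the best `l`
(`IsDensityWithMoment.measure_le`) yields the theorem.
-/

/-! ### Moments of bounded density ratios -/

/-- The left side is the moment generating function at `b / ε` of the privacy loss of randomized
response with parameter `ε`: a variable equal to `ε` with probability `e ^ ε / (e ^ ε + 1)` and to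
`-ε` otherwise. It equals `cosh b + tanh (ε / 2) * sinh b`, which leaves room for the crude bounds
`tanh (ε / 2) ≤ (e ^ ε - 1) / 2` and `sinh b ≤ 2 * b * cosh b`. -/
theorem two_point_moment_le {ε b : ℝ} (hε : 0 ≤ ε) (hb : 0 ≤ b) :
    (Real.exp ε * Real.exp b + Real.exp (-b)) / (Real.exp ε + 1) ≤
      Real.exp (b * (Real.exp ε - 1) + b ^ 2 / 2) := by
  have hE : 1 ≤ Real.exp ε := Real.one_le_exp hε
  have hsinh : Real.sinh b ≤ 2 * b * Real.cosh b := by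
    have h1 : 1 - 2 * b ≤ Real.exp (-b) * Real.exp (-b) := by
      rw [← Real.exp_add]
      linarith [Real.add_one_le_exp (-b + -b)]
    have h2 : Real.exp b * Real.exp (-b) = 1 := by rw [← Real.exp_add]; simp
    have h3 := mul_le_mul_of_nonneg_left h1 (Real.exp_pos b).le
    rw [← mul_assoc, h2] at h3
    have h4 := mul_nonneg hb (Real.exp_pos (-b)).le
    rw [Real.sinh_eq, Real.cosh_eq]
    linarith
  have hcosh := Real.cosh_le_exp_half_sq b
  have hcp := Real.cosh_pos b
  have hs0 : 0 ≤ Real.sinh b := Real.sinh_nonneg_iff.2 hb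
  have key : (Real.exp ε * Real.exp b + Real.exp (-b)) / (Real.exp ε + 1) ≤
      Real.cosh b * (b * (Real.exp ε - 1) + 1) := by
    rw [div_le_iff₀ (by positivity), ← Real.cosh_add_sinh b, ← Real.cosh_sub_sinh b]
    have h5 : (Real.exp ε - 1) * Real.sinh b ≤ (Real.exp ε - 1) * (2 * b * Real.cosh b) :=
      mul_le_mul_of_nonneg_left hsinh (by linarith)
    have h6 : 0 ≤ (Real.exp ε - 1) * (Real.exp ε - 1) * (b * Real.cosh b) := by positivity
    linarith
  refine key.trans ?_
  rw [Real.exp_add, mul_comm]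
  exact mul_le_mul (Real.add_one_le_exp _) hcosh hcp.le (Real.exp_pos _).le

/-- The convex function `r ↦ r ^ (1 + l)` lies on `[e ^ (-ε), e ^ ε]` below its chord
`r ↦ β * r - A`. The value `β - A` of the chord at `r = 1` bounds the moment of any density ratio
with mean `1` and values in this interval. -/
theorem exists_rpow_chord_bound {ε l : ℝ} (hε : 0 < ε) (hl : 0 ≤ l) :
    ∃ A β : ℝ, 0 ≤ A ∧ 0 ≤ β ∧
      β ≤ A + Real.exp (l * ε * (Real.exp ε - 1) + (l * ε) ^ 2 / 2) ∧
      ∀ r : ℝ, Real.exp (-ε) ≤ r → r ≤ Real.exp ε → r ^ (1 + l) + A ≤ β * r := by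
  have hlt : Real.exp (-ε) < Real.exp ε := Real.exp_lt_exp.2 (by linarith)
  have hE : 1 < Real.exp ε := Real.one_lt_exp_iff.2 hε
  set E := Real.exp ε with hEdef
  set F := Real.exp (-ε) with hFdef
  have hEF : E * F = 1 := by rw [hEdef, hFdef, ← Real.exp_add]; simp
  have hF : 0 < F := Real.exp_pos _
  set y := Real.exp (l * ε) with hy
  set z := Real.exp (-(l * ε)) with hz
  have hyz : z ≤ y := Real.exp_le_exp.2 (by nlinarith)
  have hz0 : 0 < z := Real.exp_pos _
  have hd : 0 < E - F := by linarith
  have hu : E ^ (1 + l) = E * y := by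
    rw [hEdef, hy, ← Real.exp_mul, ← Real.exp_add]; congr 1; ring
  have hv : F ^ (1 + l) = F * z := by
    rw [hFdef, hz, ← Real.exp_mul, ← Real.exp_add]; congr 1; ring
  have huv : F * z ≤ E * y := by nlinarith
  set β := (E * y - F * z) / (E - F) with hβ
  have hβd : β * (E - F) = E * y - F * z := by rw [hβ]; field_simp
  have hβ0 : 0 ≤ β := div_nonneg (by linarith) hd.le
  refine ⟨F * β - F * z, β, ?_, hβ0, ?_, ?_⟩
  · have h1 : z ≤ β := by
      rw [hβ, le_div_iff₀ hd]
      nlinarith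
    nlinarith
  · have h1 : β - (F * β - F * z) = (E * y + z) / (E + 1) := by
      rw [eq_div_iff (by positivity)]
      linear_combination hβd + (z - β) * hEF
    have h2 := two_point_moment_le hε.le (mul_nonneg hl hε.le)
    linarith
  · intro r hFr hrE
    set p := (r - F) / (E - F) with hp
    have hpd : p * (E - F) = r - F := by rw [hp]; field_simp
    have hp0 : 0 ≤ p := div_nonneg (by linarith) hd.le
    have hp1 : p ≤ 1 := (div_le_one hd).2 (by linarith)
    have hr : p * E + (1 - p) * F = r := by linarith
    have hconv := (convexOn_rpow (p := 1 + l) (by linarith)).2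
      (Set.mem_Ici.2 (hF.trans hlt).le) (Set.mem_Ici.2 hF.le) hp0 (sub_nonneg.2 hp1)
      (by ring)
    simp only [smul_eq_mul, hr, hu, hv] at hconv
    have hchord : p * (E * y) + (1 - p) * (F * z) = F * z - F * β + β * r := by
      linear_combination (-p) * hβd + β * hpd
    linarith

/-- The chord bound for the ratio `r = g / f` of two densities, multiplied by `f ^ (1 + l)` and
arranged without subtraction. -/
theorem ENNReal.exists_rpow_chord_bound {ε l : ℝ} (hε : 0 < ε) (hl : 0 ≤ l) :
    ∃ A β : ℝ≥0∞, A ≠ ∞ ∧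
      β ≤ A + ENNReal.ofReal (Real.exp (l * ε * (Real.exp ε - 1) + (l * ε) ^ 2 / 2)) ∧
      ∀ f g : ℝ≥0∞, f ≠ 0 → f ≠ ∞ → g ≤ ENNReal.ofReal (Real.exp ε) * f →
        f ≤ ENNReal.ofReal (Real.exp ε) * g →
        g ^ (1 + l) + A * f ^ (1 + l) ≤ β * (f ^ l * g) := by
  obtain ⟨A, β, hA, hβ, hAβ, h⟩ := _root_.exists_rpow_chord_bound hε hl
  refine ⟨ENNReal.ofReal A, ENNReal.ofReal β, ENNReal.ofReal_ne_top, ?_, ?_⟩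
  · rw [← ENNReal.ofReal_add hA (Real.exp_pos _).le]
    exact ENNReal.ofReal_le_ofReal hAβ
  · intro f g hf0 hf hgf hfg
    have hg : g ≠ ∞ := ne_top_of_le_ne_top (ENNReal.mul_ne_top ENNReal.ofReal_ne_top hf) hgf
    obtain ⟨a, ha, rfl⟩ : ∃ a : ℝ, 0 < a ∧ f = ENNReal.ofReal a :=
      ⟨f.toReal, ENNReal.toReal_pos hf0 hf, (ENNReal.ofReal_toReal hf).symm⟩
    obtain ⟨b, hb, rfl⟩ : ∃ b : ℝ, 0 ≤ b ∧ g = ENNReal.ofReal b :=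
      ⟨g.toReal, ENNReal.toReal_nonneg, (ENNReal.ofReal_toReal hg).symm⟩
    rw [← ENNReal.ofReal_mul (Real.exp_pos _).le,
      ENNReal.ofReal_le_ofReal_iff (by positivity)] at hgf hfg
    have h1 := h (b / a) (by rw [Real.exp_neg, le_div_iff₀ ha, inv_mul_le_iff₀ (Real.exp_pos _)]
                             exact hfg) (by rwa [div_le_iff₀ ha])
    rw [Real.div_rpow hb ha.le] at h1
    have hal : 0 < a ^ (1 + l) := Real.rpow_pos_of_pos ha _
    have h2 := mul_le_mul_of_nonneg_right h1 hal.le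
    have h3 : a ^ (1 + l) = a * a ^ l := by rw [Real.rpow_add ha, Real.rpow_one]
    have h4 : (b ^ (1 + l) / a ^ (1 + l) + A) * a ^ (1 + l) = b ^ (1 + l) + A * a ^ (1 + l) := by
      field_simp
    have h5 : β * (b / a) * a ^ (1 + l) = β * (a ^ l * b) := by
      rw [h3]; field_simp
    rw [h4, h5] at h2
    rw [ENNReal.ofReal_rpow_of_nonneg hb (by linarith), ENNReal.ofReal_rpow_of_pos ha,
      ENNReal.ofReal_rpow_of_pos ha, ← ENNReal.ofReal_mul hA,
      ← ENNReal.ofReal_mul (Real.rpow_nonneg ha.le _), ← ENNReal.ofReal_mul hβ,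
      ← ENNReal.ofReal_add (Real.rpow_nonneg hb _) (mul_nonneg hA hal.le)]
    exact ENNReal.ofReal_le_ofReal h2

/-! ### Composition through moments of densities -/

/-- `f` is a density of `μ` with respect to `ν`, positive and finite almost everywhere, whose
moment of order `1 + l` under `ν` is at most `K`. With `f = e ^ L` for the privacy loss `L`, this
moment is the expectation of `e ^ (l * L)` under `μ`. -/
structure IsDensityWithMoment {T : Type*} [MeasurableSpace T] (μ ν : Measure T)
    (f : T → ℝ≥0∞) (l : ℝ) (K : ℝ≥0∞) : Prop where
  measurable : Measurable f
  eq_withDensity : μ = ν.withDensity f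
  ne_zero : ∀ᵐ t ∂ν, f t ≠ 0
  ne_top : ∀ᵐ t ∂ν, f t ≠ ∞
  lintegral_le : ∫⁻ t, f t ^ (1 + l) ∂ν ≤ K

/-- One round of composition. The measures `μ'` and `ν'` extend `μ` and `ν` by one more response,
and `q` forgets it. The two inequalities of measures say that the new response is `ε`-private given
the earlier ones: the density `g` of `μ'` is within a factor `e ^ ε` of the density `f ∘ q`. No
disintegration is needed, since integrating the chord bound for `g / (f ∘ q)` only uses that
`g` is a density and that `q` maps `μ'` to `μ`. -/
theorem IsDensityWithMoment.exists_extension {T T' : Type*} [MeasurableSpace T]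
    [MeasurableSpace T'] {μ ν : Measure T} {μ' ν' : Measure T'} [IsFiniteMeasure μ']
    [IsFiniteMeasure ν'] {q : T' → T} (hq : Measurable q) (hμq : μ'.map q = μ)
    (hνq : ν'.map q = ν) {f : T → ℝ≥0∞} {l ε : ℝ} {K : ℝ≥0∞} (hε : 0 < ε) (hl : 0 ≤ l)
    (hK : K ≠ ∞) (hf : IsDensityWithMoment μ ν f l K)
    (hμν : μ' ≤ ν'.withDensity fun t => ENNReal.ofReal (Real.exp ε) * f (q t))
    (hνμ : ν' ≤ μ'.withDensity fun t => ENNReal.ofReal (Real.exp ε) * (f (q t))⁻¹) :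
    ∃ g, IsDensityWithMoment μ' ν' g l
      (K * ENNReal.ofReal (Real.exp (l * ε * (Real.exp ε - 1) + (l * ε) ^ 2 / 2))) := by
  obtain ⟨A, β, hA, hAβ, hchord⟩ := ENNReal.exists_rpow_chord_bound hε hl
  set C := ENNReal.ofReal (Real.exp (l * ε * (Real.exp ε - 1) + (l * ε) ^ 2 / 2))
  set E := ENNReal.ofReal (Real.exp ε)
  have hfm := hf.measurable
  have hac : μ' ≪ ν' :=
    (Measure.absolutelyContinuous_of_le hμν).trans (withDensity_absolutelyContinuous _ _)
  set g := μ'.rnDeriv ν' with hg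
  have hgm : Measurable g := Measure.measurable_rnDeriv _ _
  have hμ' : μ' = ν'.withDensity g := (Measure.withDensity_rnDeriv_eq _ _ hac).symm
  have hf0 : ∀ᵐ t ∂ν', f (q t) ≠ 0 := ae_of_ae_map hq.aemeasurable (hνq ▸ hf.ne_zero)
  have hft : ∀ᵐ t ∂ν', f (q t) ≠ ∞ := ae_of_ae_map hq.aemeasurable (hνq ▸ hf.ne_top)
  have hgf : ∀ᵐ t ∂ν', g t ≤ E * f (q t) := by
    refine ae_le_of_forall_setLIntegral_le_of_sigmaFinite hgm fun s hs _ => ?_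
    rw [← withDensity_apply _ hs, ← withDensity_apply _ hs, ← hμ']
    exact hμν s
  have hfg : ∀ᵐ t ∂ν', 1 ≤ g t * (E * (f (q t))⁻¹) := by
    refine ae_le_of_forall_setLIntegral_le_of_sigmaFinite measurable_one fun s hs _ => ?_
    have h := hνμ s
    rw [hμ', ← withDensity_mul _ hgm (by fun_prop), withDensity_apply _ hs] at h
    simpa using h
  have hfg' : ∀ᵐ t ∂ν', f (q t) ≤ E * g t := by
    filter_upwards [hfg, hf0, hft] with t h h0 ht
    calc f (q t) = 1 * f (q t) := (one_mul _).symm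
      _ ≤ g t * (E * (f (q t))⁻¹) * f (q t) := by gcongr
      _ = E * g t * ((f (q t))⁻¹ * f (q t)) := by ring
      _ = E * g t := by rw [ENNReal.inv_mul_cancel h0 ht, mul_one]
  refine ⟨g, hgm, hμ', ?_, ?_, ?_⟩
  · filter_upwards [hfg', hf0] with t h h0 hgt
    exact h0 (by simpa [hgt] using h)
  · filter_upwards [hgf, hft] with t h ht
    exact ne_top_of_le_ne_top (ENNReal.mul_ne_top ENNReal.ofReal_ne_top ht) h
  · -- `M` is the moment of the old density; it is finite, so it can be cancelled.
    set M := ∫⁻ t, f t ^ (1 + l) ∂ν with hM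
    have hMt : M ≠ ∞ := ne_top_of_le_ne_top hK hf.lintegral_le
    have hM1 : ∫⁻ t, f (q t) ^ (1 + l) ∂ν' = M := by
      rw [hM, ← hνq, lintegral_map (by fun_prop) hq]
    have hM2 : ∫⁻ t, f (q t) ^ l * g t ∂ν' = M := by
      calc ∫⁻ t, f (q t) ^ l * g t ∂ν' = ∫⁻ t, f (q t) ^ l ∂μ' := by
            rw [hμ', lintegral_withDensity_eq_lintegral_mul _ hgm (by fun_prop)]
            simp [mul_comm]
        _ = ∫⁻ t, f t ^ l ∂μ := by rw [← hμq, lintegral_map (by fun_prop) hq]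
        _ = M := by
            rw [hf.eq_withDensity, lintegral_withDensity_eq_lintegral_mul _ hfm (by fun_prop)]
            refine lintegral_congr_ae ?_
            filter_upwards [hf.ne_zero, hf.ne_top] with t h0 ht
            rw [Pi.mul_apply, ENNReal.rpow_add _ _ h0 ht, ENNReal.rpow_one]
    have hint : ∫⁻ t, g t ^ (1 + l) ∂ν' + A * M ≤ β * M := by
      calc ∫⁻ t, g t ^ (1 + l) ∂ν' + A * M
          = ∫⁻ t, g t ^ (1 + l) + A * f (q t) ^ (1 + l) ∂ν' := by
            rw [lintegral_add_left (by fun_prop), lintegral_const_mul _ (by fun_prop), hM1]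
        _ ≤ ∫⁻ t, β * (f (q t) ^ l * g t) ∂ν' := by
            refine lintegral_mono_ae ?_
            filter_upwards [hf0, hft, hgf, hfg'] with t h0 ht h1 h2
            exact hchord _ _ h0 ht h1 h2
        _ = β * M := by rw [lintegral_const_mul _ (by fun_prop), hM2]
    have hcancel : ∫⁻ t, g t ^ (1 + l) ∂ν' + A * M ≤ M * C + A * M :=
      hint.trans ((mul_le_mul_left hAβ M).trans_eq (by ring))
    exact ((ENNReal.add_le_add_iff_right (ENNReal.mul_ne_top hA hMt)).1 hcancel).trans
      (mul_le_mul_left hf.lintegral_le C)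

/-- A Chernoff bound: a moment of the density turns into an approximate privacy guarantee. -/
theorem IsDensityWithMoment.measure_le {T : Type*} [MeasurableSpace T] {μ ν : Measure T}
    {f : T → ℝ≥0∞} {l ε : ℝ} {K : ℝ≥0∞} (hl : 0 ≤ l) (hf : IsDensityWithMoment μ ν f l K)
    {B : Set T} (hB : MeasurableSet B) :
    μ B ≤ ENNReal.ofReal (Real.exp ε) * ν B + ENNReal.ofReal (Real.exp (-(l * ε))) * K := by
  set E := ENNReal.ofReal (Real.exp ε)
  have hfm := hf.measurable
  have hpt : ∀ t, f t ≤ E + ENNReal.ofReal (Real.exp (-(l * ε))) * f t ^ (1 + l) := by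
    intro t
    -- Where `f t > e ^ ε`, the second term is `f t * (f t / e ^ ε) ^ l`.
    rcases le_or_gt (f t) E with h | h
    · exact h.trans le_self_add
    · refine le_trans ?_ le_add_self
      have hE0 : E ≠ 0 := (ENNReal.ofReal_pos.2 (Real.exp_pos _)).ne'
      have h1 : 1 ≤ ENNReal.ofReal (Real.exp (-(l * ε))) * f t ^ l := by
        have : (1 : ℝ≥0∞) = ENNReal.ofReal (Real.exp (-(l * ε))) * E ^ l := by
          rw [ENNReal.ofReal_rpow_of_pos (Real.exp_pos _), ← Real.exp_mul,
            ← ENNReal.ofReal_mul (Real.exp_pos _).le, ← Real.exp_add]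
          simp [mul_comm]
        rw [this]
        gcongr
      calc f t = 1 * f t := (one_mul _).symm
        _ ≤ ENNReal.ofReal (Real.exp (-(l * ε))) * f t ^ l * f t := by gcongr
        _ = _ := by
          rw [add_comm, ENNReal.rpow_add_of_nonneg _ _ hl zero_le_one, ENNReal.rpow_one, mul_assoc]
  calc μ B = ∫⁻ t in B, f t ∂ν := by rw [hf.eq_withDensity, withDensity_apply _ hB]
    _ ≤ ∫⁻ t in B, E + ENNReal.ofReal (Real.exp (-(l * ε))) * f t ^ (1 + l) ∂ν :=
      lintegral_mono fun t => hpt t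
    _ = E * ν B + ENNReal.ofReal (Real.exp (-(l * ε))) * ∫⁻ t in B, f t ^ (1 + l) ∂ν := by
      rw [lintegral_add_left measurable_const, lintegral_const_mul _ (by fun_prop)]
      simp
    _ ≤ _ := by
      gcongr
      exact (setLIntegral_le_lintegral _ _).trans hf.lintegral_le

/-! ### Measures with densities and kernels -/

theorem withDensity_map_comp {T T' : Type*} [MeasurableSpace T] [MeasurableSpace T']
    (m : Measure T) {a : T → T'} (ha : Measurable a) {h : T' → ℝ≥0∞} (hh : Measurable h) :
    (m.withDensity fun t => h (a t)).map a = (m.map a).withDensity h := by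
  ext s hs
  rw [Measure.map_apply ha hs, withDensity_apply _ (ha hs), withDensity_apply _ hs,
    setLIntegral_map hs hh ha]

theorem withDensity_compProd_left {T S : Type*} [MeasurableSpace T] [MeasurableSpace S]
    (m : Measure T) [SFinite m] (κ : Kernel T S) [IsSFiniteKernel κ] {f : T → ℝ≥0∞}
    (hf : Measurable f) :
    m.withDensity f ⊗ₘ κ = (m ⊗ₘ κ).withDensity fun t => f t.1 := by
  ext s hs
  have hκ := Kernel.measurable_kernel_prodMk_left (κ := κ) hs
  rw [Measure.compProd_apply hs, lintegral_withDensity_eq_lintegral_mul _ hf hκ,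
    withDensity_apply _ hs, ← lintegral_indicator hs,
    Measure.lintegral_compProd (by measurability)]
  refine lintegral_congr fun t => ?_
  have : (fun b => s.indicator (fun x : T × S => f x.1) (t, b)) =
      (Prod.mk t ⁻¹' s).indicator fun _ => f t := by
    rfl
  rw [this, lintegral_indicator_const (measurable_prodMk_left hs)]
  rfl

theorem withDensity_le_withDensity {T : Type*} [MeasurableSpace T] {m m' : Measure T}
    (h : m ≤ m') (f : T → ℝ≥0∞) : m.withDensity f ≤ m'.withDensity f := by
  refine Measure.le_intro fun s hs _ => ?_
  rw [withDensity_apply _ hs, withDensity_apply _ hs]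
  exact lintegral_mono' (Measure.restrict_mono le_rfl h) le_rfl

theorem compProd_mono {T S : Type*} [MeasurableSpace T] [MeasurableSpace S]
    {m m' : Measure T} [SFinite m] [SFinite m'] {κ η : Kernel T S} [IsSFiniteKernel κ]
    [IsSFiniteKernel η] (hm : m ≤ m') (h : ∀ t, κ t ≤ η t) : m ⊗ₘ κ ≤ m' ⊗ₘ η := by
  refine Measure.le_intro fun s hs _ => ?_
  rw [Measure.compProd_apply hs, Measure.compProd_apply hs]
  exact lintegral_mono' hm fun t => h t _

theorem compProd_le_smul {T S : Type*} [MeasurableSpace T] [MeasurableSpace S]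
    (m : Measure T) [SFinite m] {κ η : Kernel T S} [IsSFiniteKernel κ]
    [IsSFiniteKernel η] {c : ℝ≥0∞} (h : ∀ t, κ t ≤ c • η t) : m ⊗ₘ κ ≤ c • (m ⊗ₘ η) := by
  refine Measure.le_intro fun s hs _ => ?_
  rw [Measure.smul_apply, Measure.compProd_apply hs, Measure.compProd_apply hs, smul_eq_mul,
    ← lintegral_const_mul _ (Kernel.measurable_kernel_prodMk_left hs)]
  exact lintegral_mono fun t => h t _

theorem compProd_sum_smul {ι T S : Type*} [MeasurableSpace T] [MeasurableSpace S]
    (s : Finset ι) (c : ℝ≥0∞) (m : ι → Measure T) [∀ i, SFinite (m i)]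
    [SFinite (∑ i ∈ s, c • m i)] (κ : Kernel T S)
    [IsSFiniteKernel κ] : (∑ i ∈ s, c • m i) ⊗ₘ κ = ∑ i ∈ s, c • (m i ⊗ₘ κ) := by
  ext E hE
  simp [Measure.compProd_apply hE, lintegral_finsetSum_measure, Measure.coe_finsetSum]

/-- A replacement of a part `Z` of the mass `W + Z` by `Y`, where `Z` makes up at most a fraction
`p` of the whole and `Z ≤ (1 + d) * Y`, shrinks the whole by a factor of at most `1 + d * p`. -/
theorem add_le_of_le_mul {Y Z W d p : ℝ≥0∞} (hW : W ≠ ∞) (hZ : Z ≠ ∞)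
    (hZY : Z ≤ (1 + d) * Y) (hp : Z ≤ p * (W + Z)) : W + Z ≤ (1 + d * p) * (W + Y) := by
  -- If `Y` is smaller than `Z`, then it, too, is at most a fraction `p` of its whole.
  have hYp : Z ≤ Y ∨ Y ≤ p * (W + Y) := by
    rcases le_total Z Y with h | h
    · exact Or.inl h
    right
    rcases le_total 1 p with h1 | h1
    · calc Y ≤ 1 * (W + Y) := by rw [one_mul]; exact le_add_self
        _ ≤ p * (W + Y) := by gcongr
    · have hpt : p ≠ ∞ := ne_top_of_le_ne_top ENNReal.one_ne_top h1
      have hY : Y ≠ ∞ := ne_top_of_le_ne_top hZ h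
      lift p to NNReal using hpt
      lift Y to NNReal using hY
      lift Z to NNReal using hZ
      lift W to NNReal using hW
      norm_cast at *
      rw [← NNReal.coe_le_coe] at *
      push_cast at *
      nlinarith
  rcases hYp with h | h
  · calc W + Z ≤ 1 * (W + Y) := by rw [one_mul]; gcongr
      _ ≤ _ := by gcongr; exact le_self_add
  · calc W + Z ≤ W + (1 + d) * Y := by gcongr
      _ = (W + Y) + d * Y := by ring
      _ ≤ (W + Y) + d * (p * (W + Y)) := by gcongr
      _ = _ := by ring

/-- If `a` carries at most a fraction `p` of the mass of `w + a`, then running `η` instead of `κ` on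
this part enlarges the law by a factor of at most `1 + d * p`. -/
theorem compProd_add_le {T S : Type*} [MeasurableSpace T] [MeasurableSpace S]
    {w a : Measure T} [IsFiniteMeasure w] [IsFiniteMeasure a] {κ η : Kernel T S}
    [IsMarkovKernel κ] [IsMarkovKernel η] {d p : ℝ≥0∞} (ha : a ≤ p • (w + a))
    (h : ∀ t, η t ≤ (1 + d) • κ t) :
    w ⊗ₘ κ + a ⊗ₘ η ≤ (1 + d * p) • ((w + a) ⊗ₘ κ) := by
  have h1 := compProd_le_smul a h
  have h2 := compProd_mono ha (fun t => le_refl (κ t))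
  rw [Measure.compProd_smul_left] at h2
  calc w ⊗ₘ κ + a ⊗ₘ η ≤ w ⊗ₘ κ + (1 + d) • (a ⊗ₘ κ) := by gcongr
    _ = (w + a) ⊗ₘ κ + d • (a ⊗ₘ κ) := by
      rw [Measure.compProd_add_left, add_smul, one_smul, add_assoc]
    _ ≤ (w + a) ⊗ₘ κ + d • (p • ((w + a) ⊗ₘ κ)) := by gcongr
    _ = _ := by rw [add_smul, one_smul, mul_smul]

/-- If `a` carries at most a fraction `p` of the mass of `w + a`, then running `η` instead of `κ` on
this part shrinks the law by a factor of at most `1 + d * p`. -/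
theorem compProd_le_add {T S : Type*} [MeasurableSpace T] [MeasurableSpace S]
    {w a : Measure T} [IsFiniteMeasure w] [IsFiniteMeasure a] {κ η : Kernel T S}
    [IsMarkovKernel κ] [IsMarkovKernel η] {d p : ℝ≥0∞} (ha : a ≤ p • (w + a))
    (h : ∀ t, κ t ≤ (1 + d) • η t) :
    (w + a) ⊗ₘ κ ≤ (1 + d * p) • (w ⊗ₘ κ + a ⊗ₘ η) := by
  have h1 := compProd_le_smul a h
  have h2 := compProd_mono ha (fun t => le_refl (κ t))
  rw [Measure.compProd_smul_left] at h2
  rw [Measure.compProd_add_left] at h2 ⊢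
  intro E
  exact add_le_of_le_mul (measure_ne_top _ _) (measure_ne_top _ _) (h1 E) (h2 E)

/-! ### Responses under a random swap -/

section Prefix

variable {n : ℕ} {X : Type u} {S : Fin n → Type v} [∀ i, MeasurableSpace (S i)]

/-- The first `k` of `k + 1` responses. -/
def Transcript.init {S : Fin n → Type v} {k : ℕ} (hk : k + 1 ≤ n) (t : Transcript S (k + 1) hk) :
    Transcript S k (Nat.le_of_succ_le hk) :=
  fun j => t j.castSucc

theorem Transcript.measurable_init {k : ℕ} (hk : k + 1 ≤ n) :
    Measurable (Transcript.init (S := S) hk) :=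
  measurable_pi_iff.2 fun j => measurable_pi_apply j.castSucc

theorem Transcript.init_append {S : Fin n → Type v} {k : ℕ} (hk : k + 1 ≤ n)
    (p : Transcript S k (Nat.le_of_succ_le hk) × S ⟨k, hk⟩) :
    Transcript.init hk (Transcript.append hk p) = p.1 := by
  funext j
  simp [Transcript.init, Transcript.append]

theorem map_append_compProd_init (R : Randomizers X S) [∀ i x, IsMarkovKernel (R i x)]
    {k : ℕ} (hk : k + 1 ≤ n) (m : Measure (Transcript S k (Nat.le_of_succ_le hk))) [SFinite m]
    (x : X) :
    ((m ⊗ₘ R ⟨k, hk⟩ x).map (Transcript.append hk)).map (Transcript.init hk) = m := by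
  rw [Measure.map_map (Transcript.measurable_init hk) (Transcript.measurable_append hk)]
  have : Transcript.init hk ∘ Transcript.append (S := S) hk = Prod.fst :=
    funext fun p => Transcript.init_append hk p
  rw [this]
  exact Measure.fst_compProd _ _

/-- Group privacy: each index below `k` at which the datasets differ costs one factor `c`. -/
theorem localPrefix_le_pow_smul (R : Randomizers X S) [∀ i x, IsMarkovKernel (R i x)]
    {c : ℝ≥0∞} (hc : 1 ≤ c) (hR : ∀ i s x x', R i x s ≤ c • R i x' s) {D D' : Fin n → X}
    (k : ℕ) (hk : k ≤ n) (s : Finset (Fin n)) (hs : ∀ j : Fin n, j.val < k → j ∉ s → D j = D' j) :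
    localPrefix R D k hk ≤ c ^ s.card • localPrefix R D' k hk := by
  induction k generalizing s with
  | zero =>
    intro E
    simpa [localPrefix] using mul_le_mul_left (one_le_pow₀ hc) (localPrefix R D' 0 hk E)
  | succ k ih =>
    have hk' := Nat.le_of_succ_le hk
    rw [localPrefix, localPrefix, ← Measure.map_smul]
    refine Measure.map_mono ?_ (Transcript.measurable_append hk)
    by_cases hks : (⟨k, hk⟩ : Fin n) ∈ s
    · have h1 := ih hk' (s.erase ⟨k, hk⟩) fun j hj hjs =>
        hs j (hj.trans k.lt_succ_self) fun h =>
          hjs (Finset.mem_erase.2 ⟨fun e => hj.ne (congrArg Fin.val e), h⟩)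
      rw [← Finset.card_erase_add_one hks, pow_succ', mul_smul, ← Measure.compProd_smul_left]
      refine (compProd_le_smul (localPrefix R D k hk')
        fun t => hR ⟨k, hk⟩ t (D ⟨k, hk⟩) (D' ⟨k, hk⟩)).trans ?_
      refine Measure.le_intro fun E _ _ => ?_
      rw [Measure.smul_apply, Measure.smul_apply]
      exact mul_le_mul_right (compProd_mono h1 (fun t => le_rfl) E) _
    · rw [hs ⟨k, hk⟩ k.lt_succ_self hks, ← Measure.compProd_smul_left]
      exact compProd_mono (ih hk' s fun j hj => hs j (hj.trans k.lt_succ_self)) fun t => le_rfl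

/-- The law of the first `k` responses under one random swap. -/
noncomputable def swapPrefix (R : Randomizers X S) (hn : 0 < n) (D : Fin n → X) (k : ℕ)
    (hk : k ≤ n) : Measure (Transcript S k hk) :=
  ∑ I : Fin n, (n : ℝ≥0∞)⁻¹ • localPrefix R (D ∘ Equiv.swap ⟨0, hn⟩ I) k hk

theorem swapPrefix_self (R : Randomizers X S) (hn : 0 < n) (D : Fin n → X) :
    swapPrefix R hn D n le_rfl = swapResponses R hn D := rfl

instance swapPrefix.isProbabilityMeasure (R : Randomizers X S) [∀ i x, IsMarkovKernel (R i x)]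
    (hn : 0 < n) (D : Fin n → X) (k : ℕ) (hk : k ≤ n) :
    IsProbabilityMeasure (swapPrefix R hn D k hk) := by
  refine ⟨?_⟩
  simp only [swapPrefix, Measure.coe_finsetSum, Finset.sum_apply, Measure.smul_apply,
    measure_univ, smul_eq_mul, mul_one, Finset.sum_const, Finset.card_univ, Fintype.card_fin,
    nsmul_eq_mul]
  exact ENNReal.mul_inv_cancel (by exact_mod_cast hn.ne') (ENNReal.natCast_ne_top n)

/-- A measure dominated by each of `n` measures is dominated by their average. -/
theorem le_smul_average {T : Type*} [MeasurableSpace T] (hn : 0 < n) {m : Measure T}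
    {m' : Fin n → Measure T} {c : ℝ≥0∞} (h : ∀ I, m ≤ c • m' I) :
    m ≤ c • ∑ I, (n : ℝ≥0∞)⁻¹ • m' I := by
  have hn1 : (n : ℝ≥0∞) * (n : ℝ≥0∞)⁻¹ = 1 :=
    ENNReal.mul_inv_cancel (by exact_mod_cast hn.ne') (ENNReal.natCast_ne_top n)
  refine Measure.le_intro fun E _ _ => ?_
  calc m E = ∑ _I : Fin n, (n : ℝ≥0∞)⁻¹ * m E := by
        rw [Finset.sum_const, Finset.card_univ, Fintype.card_fin, nsmul_eq_mul, ← mul_assoc, hn1,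
          one_mul]
    _ ≤ ∑ I : Fin n, (n : ℝ≥0∞)⁻¹ * (c * m' I E) := by
        gcongr with I
        exact h I E
    _ = _ := by
        simp only [Measure.smul_apply, Measure.coe_finsetSum, Finset.sum_apply,
          smul_eq_mul, Finset.mul_sum]
        exact Finset.sum_congr rfl fun I _ => by ring

theorem isFiniteMeasure_inv_natCast_smul {T : Type*} [MeasurableSpace T] (hn : 0 < n)
    (m : Measure T) [IsFiniteMeasure m] : IsFiniteMeasure ((n : ℝ≥0∞)⁻¹ • m) :=
  Measure.smul_finite _ (ENNReal.inv_ne_top.2 (by exact_mod_cast hn.ne'))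

theorem swapPrefix_map_init (R : Randomizers X S) [∀ i x, IsMarkovKernel (R i x)]
    (hn : 0 < n) (D : Fin n → X) (k : ℕ) (hk : k + 1 ≤ n) :
    (swapPrefix R hn D (k + 1) hk).map (Transcript.init hk) =
      swapPrefix R hn D k (Nat.le_of_succ_le hk) := by
  rw [swapPrefix, swapPrefix, ← Measure.mapₗ_apply_of_measurable (Transcript.measurable_init hk),
    map_sum]
  refine Finset.sum_congr rfl fun I _ => ?_
  rw [map_smul, Measure.mapₗ_apply_of_measurable (Transcript.measurable_init hk), localPrefix,
    map_append_compProd_init]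

theorem swapPrefix_zero (R : Randomizers X S) [∀ i x, IsMarkovKernel (R i x)]
    (hn : 0 < n) (D : Fin n → X) :
    swapPrefix R hn D 0 (Nat.zero_le n) = Measure.dirac fun j => j.elim0 := by
  simp only [swapPrefix, localPrefix, Finset.sum_const, Finset.card_univ, Fintype.card_fin]
  rw [← Nat.cast_smul_eq_nsmul ℝ≥0∞, smul_smul,
    ENNReal.mul_inv_cancel (by exact_mod_cast hn.ne') (ENNReal.natCast_ne_top n), one_smul]

/-- The part of `swapPrefix` in which index `k` is not the one drawn, as an unnormalized measure. -/
noncomputable def swapPrefixExcept (R : Randomizers X S) (hn : 0 < n) (D : Fin n → X) (k : ℕ)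
    (hk : k + 1 ≤ n) : Measure (Transcript S k (Nat.le_of_succ_le hk)) :=
  ∑ I ∈ Finset.univ.erase ⟨k, hk⟩,
    (n : ℝ≥0∞)⁻¹ • localPrefix R (D ∘ Equiv.swap ⟨0, hn⟩ I) k (Nat.le_of_succ_le hk)

/-- The part of `swapPrefix` in which index `k` is the one drawn, as an unnormalized measure. -/
noncomputable def swapPrefixAt (R : Randomizers X S) (hn : 0 < n) (D : Fin n → X) (k : ℕ)
    (hk : k + 1 ≤ n) : Measure (Transcript S k (Nat.le_of_succ_le hk)) :=
  (n : ℝ≥0∞)⁻¹ • localPrefix R (D ∘ Equiv.swap ⟨0, hn⟩ ⟨k, hk⟩) k (Nat.le_of_succ_le hk)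

theorem swapPrefixExcept_add_swapPrefixAt (R : Randomizers X S) (hn : 0 < n) (D : Fin n → X)
    (k : ℕ) (hk : k + 1 ≤ n) :
    swapPrefixExcept R hn D k hk + swapPrefixAt R hn D k hk =
      swapPrefix R hn D k (Nat.le_of_succ_le hk) :=
  Finset.sum_erase_add _ _ (Finset.mem_univ _)

instance swapPrefixAt.isFiniteMeasure (R : Randomizers X S) [∀ i x, IsMarkovKernel (R i x)]
    (hn : 0 < n) (D : Fin n → X) (k : ℕ) (hk : k + 1 ≤ n) :
    IsFiniteMeasure (swapPrefixAt R hn D k hk) :=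
  isFiniteMeasure_inv_natCast_smul hn _

instance swapPrefixExcept.isFiniteMeasure (R : Randomizers X S) [∀ i x, IsMarkovKernel (R i x)]
    (hn : 0 < n) (D : Fin n → X) (k : ℕ) (hk : k + 1 ≤ n) :
    IsFiniteMeasure (swapPrefixExcept R hn D k hk) :=
  isFiniteMeasure_of_le (swapPrefix R hn D k (Nat.le_of_succ_le hk))
    (swapPrefixExcept_add_swapPrefixAt R hn D k hk ▸ Measure.le_add_right le_rfl)

/-- For `k ≠ 0`, the `k`-th randomizer sees the first data element if the drawn index is `k`, and
its own data element otherwise. -/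
theorem swapPrefix_succ (R : Randomizers X S) [∀ i x, IsMarkovKernel (R i x)]
    (hn : 0 < n) (D : Fin n → X) {k : ℕ} (hk : k + 1 ≤ n) (hk0 : k ≠ 0) :
    swapPrefix R hn D (k + 1) hk =
      (swapPrefixExcept R hn D k hk ⊗ₘ R ⟨k, hk⟩ (D ⟨k, hk⟩) +
        swapPrefixAt R hn D k hk ⊗ₘ R ⟨k, hk⟩ (D ⟨0, hn⟩)).map (Transcript.append hk) := by
  have hfin : IsFiniteMeasure (swapPrefixExcept R hn D k hk) := inferInstance
  unfold swapPrefixExcept at hfin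
  have hm := Transcript.measurable_append (S := S) hk
  rw [Measure.map_add _ _ hm, swapPrefixAt, Measure.compProd_smul_left, swapPrefixExcept,
    compProd_sum_smul, Measure.map_smul, swapPrefix,
    ← Finset.sum_erase_add _ _ (Finset.mem_univ (⟨k, hk⟩ : Fin n)),
    ← Measure.mapₗ_apply_of_measurable hm, map_sum]
  congr 1
  · refine Finset.sum_congr rfl fun I hI => ?_
    have hI' : (⟨k, hk⟩ : Fin n) ≠ I := (Finset.ne_of_mem_erase hI).symm
    have h0 : (⟨k, hk⟩ : Fin n) ≠ ⟨0, hn⟩ := by simpa [Fin.ext_iff] using hk0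
    rw [map_smul, Measure.mapₗ_apply_of_measurable hm, localPrefix, Function.comp_apply,
      Equiv.swap_apply_of_ne_of_ne h0 hI']
  · rw [localPrefix, Function.comp_apply, Equiv.swap_apply_right]

/-- Given the first `k` responses, the posterior probability that the drawn index is `k` is at most
`c ^ 2 / n`: below position `k`, the dataset with index `k` drawn and the one with index `I` drawn
differ only at positions `0` and `I`. -/
theorem swapPrefixAt_le (R : Randomizers X S) [∀ i x, IsMarkovKernel (R i x)] (hn : 0 < n)
    {c : ℝ≥0∞} (hc : 1 ≤ c) (hR : ∀ i s x x', R i x s ≤ c • R i x' s) (D : Fin n → X)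
    (k : ℕ) (hk : k + 1 ≤ n) :
    swapPrefixAt R hn D k hk ≤
      (c ^ 2 * (n : ℝ≥0∞)⁻¹) • swapPrefix R hn D k (Nat.le_of_succ_le hk) := by
  have h1 : ∀ I : Fin n, localPrefix R (D ∘ Equiv.swap ⟨0, hn⟩ ⟨k, hk⟩) k (Nat.le_of_succ_le hk) ≤
      c ^ 2 • localPrefix R (D ∘ Equiv.swap ⟨0, hn⟩ I) k (Nat.le_of_succ_le hk) := by
    intro I
    refine (localPrefix_le_pow_smul R hc hR (D' := D ∘ Equiv.swap ⟨0, hn⟩ I) k _ {⟨0, hn⟩, I}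
      fun j hj hjs => ?_).trans ?_
    · simp only [Finset.mem_insert, Finset.mem_singleton, not_or] at hjs
      have hjk : j ≠ ⟨k, hk⟩ := fun e => hj.ne (congrArg Fin.val e)
      simp only [Function.comp_apply]
      rw [Equiv.swap_apply_of_ne_of_ne hjs.1 hjs.2, Equiv.swap_apply_of_ne_of_ne hjs.1 hjk]
    · intro E
      exact mul_le_mul_left (pow_le_pow_right₀ hc Finset.card_le_two) _
  rw [swapPrefixAt, mul_comm, mul_smul]
  refine Measure.le_intro fun E _ _ => ?_
  rw [Measure.smul_apply, Measure.smul_apply]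
  exact mul_le_mul_right (le_smul_average hn h1 E) _

/-- The first response sees the first data element with probability `1 / n`, and apart from that
has the same law on both datasets. -/
theorem swapPrefix_one_le (R : Randomizers X S) [∀ i x, IsMarkovKernel (R i x)] (hn : 0 < n)
    {d : ℝ≥0∞} (hR : ∀ i s x x', R i x s ≤ (1 + d) • R i x' s) {D D' : Fin n → X}
    (hD : DifferAt ⟨0, hn⟩ D D') :
    swapPrefix R hn D 1 hn ≤
      (1 + d * ((1 + d) * (n : ℝ≥0∞)⁻¹)) • swapPrefix R hn D' 1 hn := by
  have happ := Transcript.measurable_append (S := S) hn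
  set G : X → Measure (Transcript S 1 hn) := fun x =>
    (Measure.dirac (fun j => j.elim0) ⊗ₘ R ⟨0, hn⟩ x).map (Transcript.append hn) with hG
  have hGle : ∀ x x', G x ≤ (1 + d) • G x' := by
    intro x x'
    rw [hG, ← Measure.map_smul]
    exact Measure.map_mono (compProd_le_smul _ fun t => hR _ t x x') happ
  have hswap : ∀ D : Fin n → X, swapPrefix R hn D 1 hn = ∑ I, (n : ℝ≥0∞)⁻¹ • G (D I) := by
    intro D
    refine Finset.sum_congr rfl fun I _ => ?_
    rw [localPrefix, localPrefix, Function.comp_apply, Equiv.swap_apply_left]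
  have havg := le_smul_average hn fun I => hGle (D' ⟨0, hn⟩) (D' I)
  have herase : ∑ I ∈ Finset.univ.erase ⟨0, hn⟩, (n : ℝ≥0∞)⁻¹ • G (D I) =
      ∑ I ∈ Finset.univ.erase ⟨0, hn⟩, (n : ℝ≥0∞)⁻¹ • G (D' I) :=
    Finset.sum_congr rfl fun I hI => by rw [hD I (Finset.ne_of_mem_erase hI)]
  rw [← hswap] at havg
  rw [hswap D, ← Finset.sum_erase_add _ _ (Finset.mem_univ (⟨0, hn⟩ : Fin n)), herase]
  refine Measure.le_intro fun E _ _ => ?_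
  have h1 := hGle (D ⟨0, hn⟩) (D' ⟨0, hn⟩) E
  have h2 := havg E
  have h3 := congrArg (fun m => m E) (hswap D')
  rw [← Finset.sum_erase_add _ _ (Finset.mem_univ (⟨0, hn⟩ : Fin n))] at h3
  simp only [Measure.add_apply, Measure.smul_apply, smul_eq_mul] at h1 h2 h3 ⊢
  set w := (∑ I ∈ Finset.univ.erase (⟨0, hn⟩ : Fin n), (n : ℝ≥0∞)⁻¹ • G (D' I)) E
  set Q := swapPrefix R hn D' 1 hn E
  calc w + (n : ℝ≥0∞)⁻¹ * G (D ⟨0, hn⟩) E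
      ≤ w + (n : ℝ≥0∞)⁻¹ * ((1 + d) * G (D' ⟨0, hn⟩) E) := by gcongr
    _ = (w + (n : ℝ≥0∞)⁻¹ * G (D' ⟨0, hn⟩) E) + d * (n : ℝ≥0∞)⁻¹ * G (D' ⟨0, hn⟩) E := by ring
    _ ≤ Q + d * (n : ℝ≥0∞)⁻¹ * ((1 + d) * Q) := by rw [← h3]; gcongr
    _ = _ := by ring

/-- Given the earlier responses, each response of the swapped algorithm is private with a smaller
parameter. The comparison for `k ≠ 0` passes through the law in which the `k`-th randomizer always
sees its own data element, which is the same for both datasets; each of the two passages costs one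
factor `1 + d * ((1 + d) ^ 2 / n)`. -/
theorem swapPrefix_succ_le (R : Randomizers X S) [∀ i x, IsMarkovKernel (R i x)] (hn : 0 < n)
    {d : ℝ≥0∞} (hR : ∀ i s x x', R i x s ≤ (1 + d) • R i x' s) {D D' : Fin n → X}
    (hD : DifferAt ⟨0, hn⟩ D D') (k : ℕ) (hk : k + 1 ≤ n)
    {f : Transcript S k (Nat.le_of_succ_le hk) → ℝ≥0∞} (hf : Measurable f)
    (hDf : swapPrefix R hn D k (Nat.le_of_succ_le hk) =
      (swapPrefix R hn D' k (Nat.le_of_succ_le hk)).withDensity f) :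
    swapPrefix R hn D (k + 1) hk ≤ (swapPrefix R hn D' (k + 1) hk).withDensity fun t =>
      (1 + d * ((1 + d) ^ 2 * (n : ℝ≥0∞)⁻¹)) ^ 2 * f (Transcript.init hk t) := by
  have hinit := Transcript.measurable_init (S := S) hk
  have happ := Transcript.measurable_append (S := S) hk
  set c := 1 + d * ((1 + d) ^ 2 * (n : ℝ≥0∞)⁻¹) with hc
  have hd : 1 ≤ 1 + d := le_self_add
  have hat := fun D : Fin n → X => swapPrefixAt_le R hn hd hR D k hk
  simp only [← swapPrefixExcept_add_swapPrefixAt R hn _ k hk] at hat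
  by_cases hk0 : k = 0
  · subst hk0
    -- On the one-point space of empty transcripts, the density is constantly `1`.
    have hone : ∀ t, f t = 1 := by
      have h := congrArg (fun m => m Set.univ) hDf
      simp only [swapPrefix_zero, measure_univ, withDensity_apply _ MeasurableSet.univ,
        Measure.restrict_univ, lintegral_dirac' _ hf] at h
      intro t
      rw [h]
      exact congrArg f (funext fun j => j.elim0)
    simp only [hone, mul_one, withDensity_const]
    refine (swapPrefix_one_le R hn hR hD).trans (Measure.le_intro fun E _ _ => ?_)
    refine mul_le_mul_left ?_ _
    calc 1 + d * ((1 + d) * (n : ℝ≥0∞)⁻¹) ≤ c := by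
          rw [hc, sq]
          gcongr
          exact le_mul_of_one_le_left' hd
      _ ≤ c ^ 2 := le_self_pow₀ le_self_add two_ne_zero
  · have hk0' : D ⟨k, hk⟩ = D' ⟨k, hk⟩ := hD _ (by simpa [Fin.ext_iff] using hk0)
    have h1 := compProd_add_le (hat D) fun t => hR ⟨k, hk⟩ t (D ⟨0, hn⟩) (D ⟨k, hk⟩)
    have h2 := compProd_le_add (hat D') fun t => hR ⟨k, hk⟩ t (D' ⟨k, hk⟩) (D' ⟨0, hn⟩)
    rw [swapPrefixExcept_add_swapPrefixAt] at h1 h2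
    rw [hDf, withDensity_compProd_left _ _ hf, hk0'] at h1
    rw [swapPrefix_succ R hn D hk hk0, swapPrefix_succ R hn D' hk hk0, hk0']
    rw [← withDensity_map_comp _ happ (by fun_prop)]
    simp only [Transcript.init_append]
    refine Measure.map_mono (h1.trans ?_) happ
    have h3 := withDensity_le_withDensity h2 fun t => f t.1
    rw [withDensity_smul_measure] at h3
    have h4 : ∀ m : Measure (Transcript S k (Nat.le_of_succ_le hk) × S ⟨k, hk⟩),
        (m.withDensity fun t => c ^ 2 * f t.1) = c • c • m.withDensity fun t => f t.1 := by
      intro m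
      rw [smul_smul, ← sq, ← withDensity_smul _ (by fun_prop)]
      rfl
    rw [h4]
    gcongr

end Prefix

/-! ### Composition over all responses -/

/-- Adaptive composition: the moment of the density between the laws of the first `k` responses
on two neighbouring datasets grows by the same factor in each round. -/
theorem exists_isDensityWithMoment_swapPrefix {n : ℕ} (hn : 0 < n) {X : Type u}
    {S : Fin n → Type v} [∀ i, MeasurableSpace (S i)] (R : Randomizers X S)
    [∀ i x, IsMarkovKernel (R i x)] {d : ℝ≥0∞} {ε l : ℝ} (hε : 0 < ε) (hl : 0 ≤ l)
    (hR : ∀ i s x x', R i x s ≤ (1 + d) • R i x' s)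
    (hdε : (1 + d * ((1 + d) ^ 2 * (n : ℝ≥0∞)⁻¹)) ^ 2 ≤ ENNReal.ofReal (Real.exp ε))
    {D D' : Fin n → X} (hD : DifferAt ⟨0, hn⟩ D D') (k : ℕ) (hk : k ≤ n) :
    ∃ f, IsDensityWithMoment (swapPrefix R hn D k hk) (swapPrefix R hn D' k hk) f l
      (ENNReal.ofReal (Real.exp (l * ε * (Real.exp ε - 1) + (l * ε) ^ 2 / 2)) ^ k) := by
  induction k with
  | zero =>
    refine ⟨1, measurable_one, ?_, by simp, by simp, by simp⟩
    rw [swapPrefix_zero, swapPrefix_zero, withDensity_one]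
  | succ k ih =>
    obtain ⟨f, hf⟩ := ih (Nat.le_of_succ_le hk)
    have hD' : DifferAt ⟨0, hn⟩ D' D := fun j hj => (hD j hj).symm
    have hinv : swapPrefix R hn D' k (Nat.le_of_succ_le hk) =
        (swapPrefix R hn D k (Nat.le_of_succ_le hk)).withDensity fun t => (f t)⁻¹ := by
      rw [hf.eq_withDensity, withDensity_inv_same hf.measurable hf.ne_zero hf.ne_top]
    rw [pow_succ]
    refine hf.exists_extension (Transcript.measurable_init hk) (swapPrefix_map_init R hn D k hk)
      (swapPrefix_map_init R hn D' k hk) hε hl (ENNReal.pow_ne_top ENNReal.ofReal_ne_top) ?_ ?_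
    · refine (swapPrefix_succ_le R hn hR hD k hk hf.measurable hf.eq_withDensity).trans
        (withDensity_mono (ae_of_all _ fun t => ?_))
      exact mul_le_mul_left hdε _
    · refine (swapPrefix_succ_le R hn hR hD' k hk hf.measurable.inv hinv).trans
        (withDensity_mono (ae_of_all _ fun t => ?_))
      exact mul_le_mul_left hdε _

/-- With `1 + d = e ^ ε₀`, the loss per round is at most `e ^ ε₁`, by `1 + x ≤ e ^ x` for
`x = ε₁ / 2`. -/
theorem sq_one_add_swap_le {n : ℕ} (hn : 0 < n) {ε₀ : ℝ} (hε₀ : 0 ≤ ε₀) :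
    (1 + ENNReal.ofReal (Real.exp ε₀ - 1) *
      ((1 + ENNReal.ofReal (Real.exp ε₀ - 1)) ^ 2 * (n : ℝ≥0∞)⁻¹)) ^ 2 ≤
      ENNReal.ofReal (Real.exp (2 * Real.exp (2 * ε₀) * (Real.exp ε₀ - 1) / n)) := by
  have he : 0 ≤ Real.exp ε₀ - 1 := sub_nonneg.2 (Real.one_le_exp hε₀)
  have hn' : (0 : ℝ) < n := by exact_mod_cast hn
  rw [← ENNReal.ofReal_one, ← ENNReal.ofReal_add zero_le_one he, add_sub_cancel,
    ← ENNReal.ofReal_natCast n, ← ENNReal.ofReal_inv_of_pos hn',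
    ← ENNReal.ofReal_pow (Real.exp_pos _).le, ← ENNReal.ofReal_mul (by positivity),
    ← ENNReal.ofReal_mul he, ← ENNReal.ofReal_add zero_le_one (by positivity),
    ← ENNReal.ofReal_pow (by positivity)]
  refine ENNReal.ofReal_le_ofReal ?_
  set x := (Real.exp ε₀ - 1) * (Real.exp ε₀ ^ 2 * (n : ℝ)⁻¹) with hx
  have h2 : 2 * Real.exp (2 * ε₀) * (Real.exp ε₀ - 1) / n = x + x := by
    rw [two_mul ε₀, Real.exp_add, hx]
    field_simp
    ring
  have hx0 : 0 ≤ x := by positivity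
  rw [h2, Real.exp_add, sq]
  have h3 : 1 + x ≤ Real.exp x := by linarith [Real.add_one_le_exp x]
  exact mul_le_mul h3 h3 (by linarith) (Real.exp_pos _).le

theorem theorem3p4 {n : ℕ} (hn : 1 < n) {X : Type u} {S : Fin n → Type v}
    [∀ i, MeasurableSpace (S i)] (R : Randomizers X S) [∀ i x, IsMarkovKernel (R i x)]
    {ε₀ δ : ℝ} (hε₀ : 0 < ε₀) (hδ : 0 < δ)
    (hR : ∀ (i : Fin n) (s : Transcript S i i.isLt.le),
      IsDP (fun _ _ : X => True) (fun x => R i x s) ε₀ 0)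
    (ε₁ : ℝ) (hε₁ : ε₁ = 2 * Real.exp (2 * ε₀) * (Real.exp ε₀ - 1) / n) :
    IsDP (DifferAt (⟨0, Nat.zero_lt_of_lt hn⟩ : Fin n))
      (swapResponses R (Nat.zero_lt_of_lt hn))
      (ε₁ * √(2 * n * Real.log (1 / δ)) + n * ε₁ * (Real.exp ε₁ - 1)) δ := by
  intro D D' hD B hB
  have hn0 := Nat.zero_lt_of_lt hn
  have hnR : (0 : ℝ) < n := by exact_mod_cast hn0
  have he : 1 < Real.exp ε₀ := Real.one_lt_exp_iff.2 hε₀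
  have hε₁0 : 0 < ε₁ := by
    rw [hε₁]
    have := sub_pos.2 he
    positivity
  rcases le_or_gt 1 δ with h1 | h1
  · have := swapResponses.isProbabilityMeasure R hn0 D
    exact prob_le_one.trans ((ENNReal.one_le_ofReal.2 h1).trans le_add_self)
  have hR' : ∀ i s x x', R i x s ≤ (1 + ENNReal.ofReal (Real.exp ε₀ - 1)) • R i x' s := by
    intro i s x x'
    refine Measure.le_intro fun E hE _ => ?_
    have h := hR i s x x' trivial E hE
    rw [ENNReal.ofReal_zero, add_zero] at h
    rwa [Measure.smul_apply, smul_eq_mul, ← ENNReal.ofReal_one,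
      ← ENNReal.ofReal_add zero_le_one (by linarith), add_sub_cancel]
  have hlog : 0 < Real.log (1 / δ) := Real.log_pos (by rwa [lt_div_iff₀ hδ, one_mul])
  set s := √(2 * n * Real.log (1 / δ)) with hs
  have hs0 : 0 ≤ s := Real.sqrt_nonneg _
  have hs2 : s ^ 2 = 2 * n * Real.log (1 / δ) := Real.sq_sqrt (by positivity)
  -- This order `l` minimizes the exponent `-l * ε₁ * s + n * (l * ε₁) ^ 2 / 2` of the tail bound.
  have hl : 0 ≤ s / (n * ε₁) := by positivity
  obtain ⟨f, hf⟩ := exists_isDensityWithMoment_swapPrefix hn0 R hε₁0 hl hR'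
    (hε₁ ▸ sq_one_add_swap_le hn0 hε₀.le) hD n le_rfl
  rw [swapPrefix_self, swapPrefix_self] at hf
  refine (hf.measure_le hl hB
    (ε := ε₁ * s + n * ε₁ * (Real.exp ε₁ - 1))).trans (add_le_add le_rfl (le_of_eq ?_))
  rw [← ENNReal.ofReal_pow (Real.exp_pos _).le, ← ENNReal.ofReal_mul (Real.exp_pos _).le,
    ← Real.exp_nat_mul, ← Real.exp_add]
  congr 1
  have hexp : -(s / (n * ε₁) * (ε₁ * s + n * ε₁ * (Real.exp ε₁ - 1))) +
      n * (s / (n * ε₁) * ε₁ * (Real.exp ε₁ - 1) + (s / (n * ε₁) * ε₁) ^ 2 / 2) =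
      -(s ^ 2 / (2 * n)) := by
    field_simp
    ring
  rw [hexp, hs2, mul_div_right_comm, div_self (by positivity), one_mul, one_div, Real.log_inv,
    neg_neg, Real.exp_log hδ]
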